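/- Let $K$ be a field and let $(Q,\rho)$ be a locally bound quiver with zero relations: $Q$ is a locally finite quiver (each vertex is the source of finitely many arrows and the target of finitely many arrows), and $\rho$ is a set of paths of $Q$ of length at least $2$ such that for each vertex $j$ of $Q$ there is $n\ge 0$ such that the two-sided ideal $\langle\rho\rangle$ of the path algebra $KQ$ contains all paths of length exceeding $n$ with source or target $j$. Let $\Lambda=KQ/\langle\rho\rangle$ be the associated zero-relation algebra. Let $T$ be a tree, i.e. a finite quiver whose underlying undirected (multi)graph is simply connected (non-empty, connected and without cycles, loops or multiple edges), and let $F:T\to Q$ be a quiver morphism such that 1. there is no path $p$ in $T$ with $F(p)\in\langle\rho\rangle$; and 2. $F(a)\ne F(b)$ for all distinct arrows $a,b$ of $T$ with the same source or with the same target. Let $M=F_\lambda(V_T)$ be the associated (Crawley-Boevey) tree module. That is, $V_T$ is the representation of $T$ with the space $K$ at each vertex and the identity map at each arrow, and $M$ is the left $\Lambda$-module corresponding to the representation of $(Q,\rho)$ whose space at a vertex $j$ is $\bigoplus_{n\in F^{-1}(j)}K$ and on which an arrow $\gamma$ of $Q$ acts by the sum (a direct sum, by condition 2) of the identity maps from the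 summand $K$ at $n$ to the summand $K$ at $m$, over all arrows $a:n\to m$ of $T$ with $F(a)=\gamma$. Then $M$ is indecomposable: $M\neq 0$, and if $M=N_1\oplus N_2$ for two $\Lambda$-submodules $N_1,N_2$, then $N_1=0$ or $N_2=0$. -/

import Mathlib

open Quiver

noncomputable section

namespace ZeroRelation

universe u v u' v' w x

/-! ### The path algebra of a quiver -/

/-- A path of a quiver, bundled with its source and target. Paths of length zero are included. -/
structure BasisPath (Q : Type u) [Quiver.{v} Q] where
  src : Q
  tgt : Q
  path : Path src tgt

/-- The lazy path at a vertex. -/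
def BasisPath.lazy {Q : Type u} [Quiver.{v} Q] (j : Q) : BasisPath Q := ⟨j, j, Path.nil⟩

theorem BasisPath.eq_of_cast_eq {Q : Type u} [Quiver.{v} Q] {a b a' b' : Q} {p : Path a b}
    {ha : a = a'} {hb : b = b'} {r : Path a' b'} (h : p.cast ha hb = r) :
    (⟨a, b, p⟩ : BasisPath Q) = ⟨a', b', r⟩ := by
  subst ha hb h
  rfl

/-- The path algebra `KQ`: the `K`-vector space with basis the paths of `Q`. -/
def PathAlgebra (K : Type w) [Field K] (Q : Type u) [Quiver.{v} Q] : Type _ := BasisPath Q →₀ K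

namespace PathAlgebra

variable {K : Type w} [Field K] {Q : Type u} [Quiver.{v} Q]

instance : AddCommGroup (PathAlgebra K Q) := inferInstanceAs (AddCommGroup (BasisPath Q →₀ K))
instance : Module K (PathAlgebra K Q) := inferInstanceAs (Module K (BasisPath Q →₀ K))

variable (K) in
/-- The basis element of `KQ` given by a path. -/
def ofPath (p : BasisPath Q) : PathAlgebra K Q := Finsupp.single p (1 : K)

variable (K) in
/-- The linear map on `KQ` with prescribed values on paths. -/
def lift {M : Type x} [AddCommGroup M] [Module K M] (f : BasisPath Q → M) :
    PathAlgebra K Q →ₗ[K] M :=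
  Finsupp.linearCombination K f

@[simp] theorem lift_ofPath {M : Type x} [AddCommGroup M] [Module K M] (f : BasisPath Q → M)
    (p : BasisPath Q) : lift K f (ofPath K p) = f p :=
  (Finsupp.linearCombination_single K (1 : K) p).trans (one_smul K _)

theorem hom_ext {M : Type x} [AddCommGroup M] [Module K M] {f g : PathAlgebra K Q →ₗ[K] M}
    (h : ∀ p, f (ofPath K p) = g (ofPath K p)) : f = g :=
  Finsupp.lhom_ext' fun p => LinearMap.ext_ring (h p)

open Classical in
variable (K) in
/-- The product `p q` of two paths, "first `q`, then `p`"; it is zero if the target of `q` is not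
the source of `p`. With this convention representations of `Q` are left `KQ`-modules. -/
def mulPath (p q : BasisPath Q) : PathAlgebra K Q :=
  if h : q.tgt = p.src then ofPath K ⟨q.src, p.tgt, q.path.comp (p.path.cast h.symm rfl)⟩ else 0

variable (K Q) in
/-- The multiplication of `KQ`, extended bilinearly from paths. -/
def mulHom : PathAlgebra K Q →ₗ[K] PathAlgebra K Q →ₗ[K] PathAlgebra K Q :=
  lift K fun p => lift K fun q => mulPath K p q

instance : Mul (PathAlgebra K Q) := ⟨fun a b => mulHom K Q a b⟩

theorem mul_def (a b : PathAlgebra K Q) : a * b = mulHom K Q a b := rfl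

theorem ofPath_mul_ofPath (p q : BasisPath Q) : ofPath K p * ofPath K q = mulPath K p q := by
  simp [mul_def, mulHom]

theorem mulPath_of_eq {a b c : Q} (q : Path a b) (p : Path b c) :
    mulPath K ⟨b, c, p⟩ ⟨a, b, q⟩ = ofPath K ⟨a, c, q.comp p⟩ := by
  simp [mulPath]

theorem mulPath_of_ne {p q : BasisPath Q} (h : q.tgt ≠ p.src) : mulPath K p q = 0 := by
  simp [mulPath, h]

theorem mul_assoc_ofPath (p q r : BasisPath Q) :
    ofPath K p * ofPath K q * ofPath K r = ofPath K p * (ofPath K q * ofPath K r) := by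
  obtain ⟨p₀, p₁, p⟩ := p
  obtain ⟨q₀, q₁, q⟩ := q
  obtain ⟨r₀, r₁, r⟩ := r
  simp only [ofPath_mul_ofPath]
  by_cases h : q₁ = p₀
  · subst h
    by_cases h' : r₁ = q₀
    · subst h'
      simp only [mulPath_of_eq, ofPath_mul_ofPath, Path.comp_assoc]
    · rw [mulPath_of_eq, ofPath_mul_ofPath, mulPath_of_ne h', mulPath_of_ne h', mul_def, map_zero]
  · rw [mulPath_of_ne (p := ⟨p₀, p₁, p⟩) (q := ⟨q₀, q₁, q⟩) h, mul_def, map_zero,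
      LinearMap.zero_apply]
    by_cases h' : r₁ = q₀
    · subst h'
      rw [mulPath_of_eq, ofPath_mul_ofPath, mulPath_of_ne h]
    · rw [mulPath_of_ne h', mul_def, map_zero]

instance : NonUnitalRing (PathAlgebra K Q) where
  left_distrib a b c := by simp [mul_def]
  right_distrib a b c := by simp [mul_def]
  zero_mul a := by simp [mul_def]
  mul_zero a := by simp [mul_def]
  mul_assoc a b c := by
    let L : PathAlgebra K Q →ₗ[K] PathAlgebra K Q →ₗ[K] PathAlgebra K Q →ₗ[K] PathAlgebra K Q :=
      LinearMap.mk₂ K (fun a b => mulHom K Q (mulHom K Q a b))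
        (by intros; simp) (by intros; simp) (by intros; simp) (by intros; simp)
    let R : PathAlgebra K Q →ₗ[K] PathAlgebra K Q →ₗ[K] PathAlgebra K Q →ₗ[K] PathAlgebra K Q :=
      LinearMap.mk₂ K (fun a b => (mulHom K Q a).comp (mulHom K Q b))
        (by intros; ext; simp) (by intros; ext; simp) (by intros; ext; simp)
        (by intros; ext; simp)
    have : L = R := hom_ext fun p => hom_ext fun q => hom_ext fun r => mul_assoc_ofPath p q r
    exact congrArg (fun f => f a b c) this

instance : IsScalarTower K (PathAlgebra K Q) (PathAlgebra K Q) :=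
  ⟨fun c a b => by simp [mul_def]⟩

instance : SMulCommClass K (PathAlgebra K Q) (PathAlgebra K Q) :=
  ⟨fun c a b => by simp [mul_def]⟩

end PathAlgebra

/-! ### Zero relations and zero-relation algebras -/

section Algebra

variable (K : Type w) [Field K] {Q : Type u} [Quiver.{v} Q] (ρ : Set (BasisPath Q))

/-- The two-sided ideal `⟨ρ⟩` of `KQ` generated by a set `ρ` of paths. -/
def relIdeal : TwoSidedIdeal (PathAlgebra K Q) :=
  TwoSidedIdeal.span (PathAlgebra.ofPath K '' ρ)

/-- `(Q, ρ)` is a locally bound quiver with zero relations: `Q` is locally finite, `ρ` consists of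
paths of length at least two, and for every vertex `j` the ideal `⟨ρ⟩` contains all sufficiently
long paths with source or target `j`. -/
structure IsLocallyBound : Prop where
  finite_star : ∀ j : Q, Finite (Star j)
  finite_costar : ∀ j : Q, Finite (Costar j)
  two_le_length : ∀ p ∈ ρ, 2 ≤ p.path.length
  exists_bound : ∀ j : Q, ∃ n : ℕ, ∀ p : BasisPath Q,
    (p.src = j ∨ p.tgt = j) → n < p.path.length → PathAlgebra.ofPath K p ∈ relIdeal K ρ

/-- The zero-relation algebra `Λ = KQ/⟨ρ⟩`. It has a unit only if `Q` has finitely many vertices. -/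
abbrev ZeroRelationAlgebra : Type _ := (relIdeal K ρ).ringCon.Quotient

variable {K ρ}

theorem smul_mem_relIdeal (c : K) {a : PathAlgebra K Q} (ha : a ∈ relIdeal K ρ) :
    c • a ∈ relIdeal K ρ := by
  let J : TwoSidedIdeal (PathAlgebra K Q) := TwoSidedIdeal.mk' {a | c • a ∈ relIdeal K ρ}
    (by simp)
    (fun {x y} hx hy => by simpa using (relIdeal K ρ).add_mem hx hy)
    (fun {x} hx => by simpa using (relIdeal K ρ).neg_mem hx)
    (fun {x y} hy => by
      simpa [mul_smul_comm] using (relIdeal K ρ).mul_mem_left x _ hy)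
    (fun {x y} hx => by
      simpa [smul_mul_assoc] using (relIdeal K ρ).mul_mem_right _ y hx)
  have hJ : relIdeal K ρ ≤ J := by
    refine TwoSidedIdeal.span_le.2 ?_
    rintro _ ⟨p, hp, rfl⟩
    have h : c • PathAlgebra.ofPath K p =
        (c • PathAlgebra.ofPath K (BasisPath.lazy p.tgt)) * PathAlgebra.ofPath K p := by
      obtain ⟨p₀, p₁, p⟩ := p
      rw [smul_mul_assoc, PathAlgebra.ofPath_mul_ofPath, BasisPath.lazy,
        PathAlgebra.mulPath_of_eq, Path.comp_nil]
    change PathAlgebra.ofPath K p ∈ J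
    rw [TwoSidedIdeal.mem_mk', Set.mem_ofPred_eq, h]
    exact (relIdeal K ρ).mul_mem_left _ _ (TwoSidedIdeal.subset_span ⟨p, hp, rfl⟩)
  have := hJ ha
  rwa [TwoSidedIdeal.mem_mk'] at this

namespace ZeroRelationAlgebra

variable (K ρ) in
/-- The quotient map `KQ → Λ`. -/
def mk (a : PathAlgebra K Q) : ZeroRelationAlgebra K ρ := RingCon.toQuotient a

theorem mk_surjective : Function.Surjective (mk K ρ) := Quotient.mk''_surjective

instance : SMul K (ZeroRelationAlgebra K ρ) where
  smul c := Quotient.map' (c • ·) fun a b h => by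
    have h' : (relIdeal K ρ).ringCon a b := h
    change (relIdeal K ρ).ringCon (c • a) (c • b)
    rw [TwoSidedIdeal.rel_iff] at h' ⊢
    rw [← smul_sub]
    exact smul_mem_relIdeal c h'

instance : Module K (ZeroRelationAlgebra K ρ) :=
  Function.Surjective.module K
    (⟨⟨mk K ρ, rfl⟩, fun _ _ => rfl⟩ : PathAlgebra K Q →+ ZeroRelationAlgebra K ρ)
    mk_surjective (fun _ _ => rfl)

end ZeroRelationAlgebra

end Algebra

/-! ### Left modules over an algebra that need not have a unit -/

/-- A left module over an associative `K`-algebra `A` without a chosen unit: a `K`-vector space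
`M` with a `K`-linear multiplicative action of `A` such that `A M = M`. -/
structure LeftModule (K : Type w) [Field K] (A : Type u) [NonUnitalRing A] [Module K A] where
  carrier : Type x
  [addCommGroup : AddCommGroup carrier]
  [module : Module K carrier]
  act : A →ₙₐ[K] Module.End K carrier
  unitary : Submodule.span K {y | ∃ a m, y = act a m} = ⊤

attribute [instance] LeftModule.addCommGroup LeftModule.module

namespace LeftModule

variable {K : Type w} [Field K] {A : Type u} [NonUnitalRing A] [Module K A]

/-- A subspace is an `A`-submodule if it is stable under the action. -/
def IsSubmodule (M : LeftModule.{u, w, x} K A) (N : Submodule K M.carrier) : Prop :=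
  ∀ (a : A), ∀ m ∈ N, M.act a m ∈ N

/-- A module is indecomposable if it is non-zero and is not the direct sum of two non-zero
submodules. -/
def Indecomposable (M : LeftModule.{u, w, x} K A) : Prop :=
  Nontrivial M.carrier ∧ ∀ N₁ N₂ : Submodule K M.carrier,
    M.IsSubmodule N₁ → M.IsSubmodule N₂ → IsCompl N₁ N₂ → N₁ = ⊥ ∨ N₂ = ⊥

end LeftModule

/-! ### Representations -/

/-- A `K`-representation of a quiver. -/
structure Rep (K : Type w) [Field K] (Q : Type u) [Quiver.{v} Q] where
  V : Q → Type x
  [addCommGroup : ∀ j, AddCommGroup (V j)]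
  [module : ∀ j, Module K (V j)]
  map : ∀ {j k : Q}, (j ⟶ k) → V j →ₗ[K] V k

attribute [instance] Rep.addCommGroup Rep.module

namespace Rep

variable {K : Type w} [Field K] {Q : Type u} [Quiver.{v} Q] (M : Rep.{u, v, w, x} K Q)

/-- The linear map of a representation along a path. -/
def mapPath {j : Q} : ∀ {k : Q}, Path j k → (M.V j →ₗ[K] M.V k)
  | _, Path.nil => LinearMap.id
  | _, Path.cons p γ => (M.map γ).comp (mapPath p)

theorem mapPath_comp {j k : Q} (p : Path j k) : ∀ {l : Q} (q : Path k l),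
    M.mapPath (p.comp q) = (M.mapPath q).comp (M.mapPath p)
  | _, Path.nil => rfl
  | _, Path.cons q γ => by
    rw [Path.comp_cons, mapPath, mapPath, mapPath_comp p q, LinearMap.comp_assoc]

/-- A representation is bound by `ρ` if all paths in `ρ` act as zero. -/
def IsBound (ρ : Set (BasisPath Q)) : Prop := ∀ p ∈ ρ, M.mapPath p.path = 0

/-- The underlying vector space `⨁ⱼ Vⱼ` of the module given by a representation. -/
abbrev Total : Type _ := DirectSum Q M.V

open Classical in
/-- A path from `j` to `k` acts on `⨁ⱼ Vⱼ` by its map `Vⱼ → Vₖ`, and by zero on the other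
summands. -/
def actPath (p : BasisPath Q) : Module.End K M.Total :=
  (DirectSum.lof K Q M.V p.tgt).comp
    ((M.mapPath p.path).comp (DirectSum.component K Q M.V p.src))

/-- The action of `KQ` on `⨁ⱼ Vⱼ`. -/
def actPathAlgebra : PathAlgebra K Q →ₙₐ[K] Module.End K M.Total :=
  { PathAlgebra.lift K M.actPath with
    map_zero' := (PathAlgebra.lift K M.actPath).map_zero
    map_mul' := by
      classical
      intro a b
      let f := PathAlgebra.lift K M.actPath
      let L : PathAlgebra K Q →ₗ[K] PathAlgebra K Q →ₗ[K] Module.End K M.Total :=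
        LinearMap.mk₂ K (fun a b => f (a * b)) (by intros; simp [add_mul])
          (by intros; simp [smul_mul_assoc]) (by intros; simp [mul_add])
          (by intros; simp [mul_smul_comm])
      let R : PathAlgebra K Q →ₗ[K] PathAlgebra K Q →ₗ[K] Module.End K M.Total :=
        LinearMap.mk₂ K (fun a b => f a * f b) (by intros; simp [add_mul])
          (by intros; simp) (by intros; simp [mul_add]) (by intros; simp)
      have : L = R := by
        refine PathAlgebra.hom_ext fun p => PathAlgebra.hom_ext fun q => ?_
        change f (PathAlgebra.ofPath K p * PathAlgebra.ofPath K q) =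
          f (PathAlgebra.ofPath K p) * f (PathAlgebra.ofPath K q)
        obtain ⟨p₀, p₁, p⟩ := p
        obtain ⟨q₀, q₁, q⟩ := q
        rw [PathAlgebra.ofPath_mul_ofPath]
        simp only [f, PathAlgebra.lift_ofPath]
        by_cases h : q₁ = p₀
        · subst h
          rw [PathAlgebra.mulPath_of_eq, PathAlgebra.lift_ofPath]
          ext1 i
          ext1 m
          simp [actPath, mapPath_comp, DirectSum.component.lof_self]
        · rw [PathAlgebra.mulPath_of_ne h, map_zero]
          ext1 i
          ext1 m
          simp [actPath, DirectSum.component.of, h]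
      exact congrArg (fun g => g a b) this }

theorem actPathAlgebra_ofPath (p : BasisPath Q) :
    M.actPathAlgebra (PathAlgebra.ofPath K p) = M.actPath p :=
  PathAlgebra.lift_ofPath M.actPath p

variable {M} {ρ : Set (BasisPath Q)}

theorem IsBound.relIdeal_le_ker (hM : M.IsBound ρ) :
    relIdeal K ρ ≤ TwoSidedIdeal.ker M.actPathAlgebra := by
  refine TwoSidedIdeal.span_le.2 ?_
  rintro _ ⟨p, hp, rfl⟩
  rw [SetLike.mem_coe, TwoSidedIdeal.mem_ker, actPathAlgebra_ofPath, actPath, hM p hp]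
  simp

/-- The action of `Λ = KQ/⟨ρ⟩` on `⨁ⱼ Vⱼ` induced by the action of `KQ`, for a representation
bound by `ρ`. -/
def IsBound.act (hM : M.IsBound ρ) : ZeroRelationAlgebra K ρ →ₙₐ[K] Module.End K M.Total where
  toFun := Quotient.lift M.actPathAlgebra fun a b (h : (relIdeal K ρ).ringCon a b) =>
    TwoSidedIdeal.ker_ringCon M.actPathAlgebra |>.1 (TwoSidedIdeal.ringCon_le_iff.1
      hM.relIdeal_le_ker h)
  map_smul' c a := by
    obtain ⟨a, rfl⟩ := ZeroRelationAlgebra.mk_surjective a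
    exact map_smul M.actPathAlgebra c a
  map_zero' := map_zero M.actPathAlgebra
  map_add' a b := by
    obtain ⟨a, rfl⟩ := ZeroRelationAlgebra.mk_surjective a
    obtain ⟨b, rfl⟩ := ZeroRelationAlgebra.mk_surjective b
    exact map_add M.actPathAlgebra a b
  map_mul' a b := by
    obtain ⟨a, rfl⟩ := ZeroRelationAlgebra.mk_surjective a
    obtain ⟨b, rfl⟩ := ZeroRelationAlgebra.mk_surjective b
    exact map_mul M.actPathAlgebra a b

theorem IsBound.act_mk (hM : M.IsBound ρ) (a : PathAlgebra K Q) :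
    hM.act (ZeroRelationAlgebra.mk K ρ a) = M.actPathAlgebra a := rfl

/-- The left `Λ`-module corresponding to a representation bound by `ρ`. -/
def IsBound.toLeftModule (hM : M.IsBound ρ) : LeftModule K (ZeroRelationAlgebra K ρ) where
  carrier := M.Total
  act := hM.act
  unitary := by
    classical
    refine eq_top_iff.2 fun m _ => ?_
    induction m using DirectSum.induction_on with
    | zero => exact Submodule.zero_mem _
    | of j m =>
      refine Submodule.subset_span ⟨ZeroRelationAlgebra.mk K ρ
        (PathAlgebra.ofPath K (BasisPath.lazy j)), DirectSum.lof K Q M.V j m, ?_⟩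
      rw [hM.act_mk, actPathAlgebra_ofPath]
      change DirectSum.lof K Q M.V j m = DirectSum.lof K Q M.V j
        (DirectSum.component K Q M.V j (DirectSum.lof K Q M.V j m))
      rw [DirectSum.component.lof_self]
    | add m n hm hn => exact Submodule.add_mem _ (hm trivial) (hn trivial)

end Rep

/-! ### Trees and tree modules -/

/-- The underlying simple graph of a quiver. -/
def underlyingGraph (T : Type u') [Quiver.{v'} T] : SimpleGraph T :=
  SimpleGraph.fromRel fun n m : T => Nonempty (n ⟶ m)

/-- The underlying undirected (multi)graph of a quiver is simply connected: it has no loops, at most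
one edge between any two vertices, and as a simple graph it is non-empty, connected and acyclic. -/
structure IsTree (T : Type u') [Quiver.{v'} T] : Prop where
  no_loop : ∀ n : T, IsEmpty (n ⟶ n)
  no_multiple : ∀ n m : T, Subsingleton ((n ⟶ m) ⊕ (m ⟶ n))
  graph_isTree : (underlyingGraph T).IsTree

section TreeModule

variable (K : Type w) [Field K] {Q : Type u} [Quiver.{v} Q] {T : Type u'} [Quiver.{v'} T]

/-- `F : T → (Q, ρ)` is a bound quiver morphism: no path `p` of `T` has `F(p) ∈ ⟨ρ⟩`. -/
def IsBoundMorphism (ρ : Set (BasisPath Q)) (F : T ⥤q Q) : Prop :=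
  ∀ (n m : T) (p : Path n m),
    PathAlgebra.ofPath K ⟨F.obj n, F.obj m, F.mapPath p⟩ ∉ relIdeal K ρ

/-- The tree module condition: distinct arrows of `T` with the same source, or with the same target,
have distinct images under `F`. -/
def TreeModuleCondition (F : T ⥤q Q) : Prop :=
  (∀ n : T, Function.Injective (F.star n)) ∧ (∀ n : T, Function.Injective (F.costar n))

/-- The vertices of `T` above the vertex `j` of `Q`. -/
abbrev VertexFiber (F : T ⥤q Q) (j : Q) : Type u' := {n : T // F.obj n = j}

/-- The arrows `n → m` of `T` above the arrow `γ : j → k` of `Q`, for `n` above `j` and `m`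
above `k`. -/
abbrev ArrowFiber (F : T ⥤q Q) {j k : Q} (γ : j ⟶ k) (n : VertexFiber F j) (m : VertexFiber F k) :
    Type v' :=
  {a : n.1 ⟶ m.1 // (F.map a).cast n.2 m.2 = γ}

variable {K}

open Classical in
/-- The map `(F_λ U)ⱼ → (F_λ U)ₖ` given by an arrow `γ : j → k` of `Q`: the sum of the maps `ψₐ` over
all arrows `a : n → m` of `T` with `F(a) = γ`, each extended by zero to a map
`⨁_{F(n) = j} Uₙ → ⨁_{F(m) = k} Uₘ`. -/
def pushDownMap [Finite T] [∀ n m : T, Finite (n ⟶ m)] (F : T ⥤q Q)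
    (U : Rep.{u', v', w, x} K T) {j k : Q} (γ : j ⟶ k) :
    (DirectSum (VertexFiber F j) fun n => U.V n.1) →ₗ[K]
      DirectSum (VertexFiber F k) fun m => U.V m.1 :=
  letI := Fintype.ofFinite (VertexFiber F j)
  letI := Fintype.ofFinite (VertexFiber F k)
  letI := fun n m => Fintype.ofFinite (ArrowFiber F γ n m)
  ∑ n : VertexFiber F j, ∑ m : VertexFiber F k, ∑ a : ArrowFiber F γ n m,
    (DirectSum.lof K (VertexFiber F k) (fun m => U.V m.1) m).comp
      ((U.map a.1).comp (DirectSum.component K (VertexFiber F j) (fun n => U.V n.1) n))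

/-- The push-down `F_λ U` of a representation `U` of a finite quiver `T` along `F : T → Q`:
`(F_λ U)ⱼ` is the direct sum of the `Uₙ` with `F(n) = j`. Under the tree module condition the sum in
`pushDownMap` is the direct sum of the maps `ψₐ`. -/
def pushDown [Finite T] [∀ n m : T, Finite (n ⟶ m)] (F : T ⥤q Q) (U : Rep.{u', v', w, x} K T) :
    Rep.{u, v, w, max u' x} K Q where
  V j := DirectSum (VertexFiber F j) fun n => U.V n.1
  map γ := pushDownMap F U γ

variable (K T) in
/-- The representation `V_T` with a copy of `K` at every vertex and the identity at every arrow. -/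
def constRep : Rep.{u', v', w, w} K T where
  V _ := K
  map _ := LinearMap.id

open Classical in
/-- A path of `Q` maps the summand of `F_λ U` at `n` into the sum of the summands at the ends of its
lifts to `T` starting at `n`. -/
theorem mapPath_pushDown_mem [Finite T] [∀ n m : T, Finite (n ⟶ m)] (F : T ⥤q Q)
    (U : Rep.{u', v', w, x} K T) {j k : Q} (r : Path j k) (n : VertexFiber F j) (y : U.V n.1) :
    (pushDown F U).mapPath r (DirectSum.lof K (VertexFiber F j) (fun n => U.V n.1) n y) ∈
      Submodule.span K {z : (pushDown F U).V k | ∃ (m : VertexFiber F k) (p : Path n.1 m.1)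
        (y' : U.V m.1), (F.mapPath p).cast n.2 m.2 = r ∧
          z = DirectSum.lof K (VertexFiber F k) (fun m => U.V m.1) m y'} := by
  induction r with
  | nil =>
    exact Submodule.subset_span ⟨n, Path.nil, y, by simp, rfl⟩
  | @cons k l r γ ih =>
    refine Submodule.span_le.2 ?_
      (Submodule.apply_mem_span_image_of_mem_span (pushDownMap F U γ) ih)
    rintro _ ⟨_, ⟨m, p, y', hp, rfl⟩, rfl⟩
    simp only [pushDownMap, LinearMap.sum_apply, LinearMap.comp_apply]
    refine Submodule.sum_mem _ fun n' _ => Submodule.sum_mem _ fun m' _ =>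
      Submodule.sum_mem _ fun a _ => ?_
    by_cases h : m = n'
    · subst h
      refine Submodule.subset_span ⟨m', p.cons a.1, _, ?_, rfl⟩
      obtain ⟨m, rfl⟩ := m
      obtain ⟨m', rfl⟩ := m'
      obtain ⟨n, rfl⟩ := n
      obtain ⟨a, rfl⟩ := a
      subst hp
      rfl
    · rw [DirectSum.component.of, dif_neg h, map_zero, map_zero]
      exact Submodule.zero_mem _

/-- The push-down of a representation along a bound quiver morphism is bound by `ρ`. -/
theorem IsBoundMorphism.isBound_pushDown [Finite T] [∀ n m : T, Finite (n ⟶ m)]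
    {ρ : Set (BasisPath Q)} {F : T ⥤q Q} (hF : IsBoundMorphism K ρ F)
    (U : Rep.{u', v', w, x} K T) : (pushDown F U).IsBound ρ := by
  classical
  rintro ⟨j, k, r⟩ hr
  refine DirectSum.linearMap_ext K fun n => LinearMap.ext fun y => ?_
  refine (Submodule.mem_bot K).1 (Submodule.span_le.2 ?_ (mapPath_pushDown_mem F U r n y))
  rintro _ ⟨m, p, y', hp, rfl⟩
  exfalso
  exact hF _ _ p (TwoSidedIdeal.subset_span
    ⟨_, hr, congrArg (PathAlgebra.ofPath K) (BasisPath.eq_of_cast_eq hp).symm⟩)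

/-- The left `Λ`-module `F_λ(V_T)`, for a finite quiver `T` and a bound quiver morphism
`F : T → (Q, ρ)`. It is a tree module if `T` is a tree and `F` satisfies the tree module
condition. -/
def pushDownModule [Finite T] [∀ n m : T, Finite (n ⟶ m)] {ρ : Set (BasisPath Q)} {F : T ⥤q Q}
    (hF : IsBoundMorphism K ρ F) : LeftModule K (ZeroRelationAlgebra K ρ) :=
  (hF.isBound_pushDown (constRep K T)).toLeftModule

end TreeModule

end ZeroRelation

end

noncomputable section

namespace ZeroRelation

universe u v u' v' w x

/-! ### Labelled graphs -/

/-! A decomposition of `M` gives an idempotent endomorphism, so it suffices that such a `P` is 0 or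
1. In the basis of `M` indexed by the vertices of `T`, `P` is a matrix. Label each arrow of `T` by
its image in `Q`. Commuting with the arrows of `Q` means that `P` takes the same value at the two
ends of any pair of equally labelled arrows, and vanishes where the partner arrow needed for such a
pair is missing. Hence the support of `P` is a simulation: if `P m n ≠ 0`, arrows out of `m` lift to
arrows out of `n`, and arrows into `n` to arrows into `m`, with the support preserved
(`IsEndomorphism.simulates`).

The crux is that simulation is antisymmetric (`Simulates.antisymm`). Mutual simulation is a
bisimulation, and by the tree module condition and connectedness all its classes, of vertices and of
arrows, have one common size `d`. So `d` divides both the number of vertices and the number of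
arrows; for a tree these differ by one, whence `d = 1`.

Thus `P` is triangular for a partial order, and its diagonal is constant by connectedness.
Idempotence makes the diagonal value 0 or 1. An idempotent strictly triangular matrix is zero; this
applies to `P` or to `1 - P`. -/

theorem dvd_natCard_of_classes {α : Type*} [Finite α] (r : Setoid α) (d : ℕ)
    (h : ∀ x, Nat.card {y // r x y} = d) : d ∣ Nat.card α := by
  classical
  have := Fintype.ofFinite (Quotient r)
  rw [← Nat.card_congr (Equiv.sigmaFiberEquiv (Quotient.mk r)), Nat.card_sigma]
  refine Finset.dvd_sum fun q _ => ?_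
  obtain ⟨x, rfl⟩ := Quotient.exists_rep q
  rw [← h x]
  refine (Nat.card_congr (Equiv.subtypeEquivRight fun y => ?_)).dvd
  rw [Quotient.eq]
  exact ⟨r.symm, r.symm⟩

/-- A connected directed graph whose edges carry labels, such that an edge is determined by its
label and its source, and also by its label and its target. -/
structure LabelledGraph (V : Type*) (E : Type*) (L : Type*) where
  src : E → V
  tgt : E → V
  lab : E → L
  eq_of_src : ∀ {a b}, src a = src b → lab a = lab b → a = b
  eq_of_tgt : ∀ {a b}, tgt a = tgt b → lab a = lab b → a = b
  connected : ∀ x y, Relation.EqvGen (fun x y => ∃ a, src a = x ∧ tgt a = y) x y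

namespace LabelledGraph

variable {V E L : Type*} (G : LabelledGraph V E L)

theorem eq_of_forall_edge {α : Type*} (f : V → α) (h : ∀ a, f (G.src a) = f (G.tgt a)) (x y : V) :
    f x = f y := by
  induction G.connected x y with
  | rel x y hxy => obtain ⟨a, rfl, rfl⟩ := hxy; exact h a
  | refl => rfl
  | symm _ _ _ ih => exact ih.symm
  | trans _ _ _ _ _ ih₁ ih₂ => exact ih₁.trans ih₂

/-! ### Bisimulations and the sizes of their classes -/

/-- An equivalence relation on the vertices along which edges can be lifted. -/
structure IsBisimulation (r : Setoid V) : Prop where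
  lift_src : ∀ a y, r (G.src a) y → ∃ b, G.src b = y ∧ G.lab b = G.lab a ∧ r (G.tgt a) (G.tgt b)
  lift_tgt : ∀ a y, r (G.tgt a) y → ∃ b, G.tgt b = y ∧ G.lab b = G.lab a ∧ r (G.src a) (G.src b)

namespace IsBisimulation

variable {G} {r : Setoid V} (hr : G.IsBisimulation r)
include hr

/-- The lift of `a` to `G.src b` has the source and label of `b`, so it is `b`. -/
theorem rel_tgt {a b : E} (h : r (G.src a) (G.src b)) (hl : G.lab b = G.lab a) :
    r (G.tgt a) (G.tgt b) := by
  obtain ⟨c, h₁, h₂, h₃⟩ := hr.lift_src a _ h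
  rwa [G.eq_of_src h₁ (h₂.trans hl.symm)] at h₃

/-- Taking sources is a bijection between the two classes: labels separate edges with a common
source, and `lift_src` gives surjectivity. With its counterpart for targets, this shows that the two
ends of an edge have classes of equal size. -/
theorem card_edgeClass_eq_src (a : E) :
    Nat.card {b // r (G.src a) (G.src b) ∧ G.lab a = G.lab b} =
      Nat.card {y // r (G.src a) y} := by
  refine Nat.card_congr (Equiv.ofBijective (fun b => ⟨G.src b.1, b.2.1⟩) ⟨?_, ?_⟩)
  · rintro ⟨b, hb⟩ ⟨c, hc⟩ h
    exact Subtype.ext (G.eq_of_src (congrArg Subtype.val h) (hb.2.symm.trans hc.2))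
  · rintro ⟨y, hy⟩
    obtain ⟨b, rfl, h₂, -⟩ := hr.lift_src a y hy
    exact ⟨⟨b, hy, h₂.symm⟩, rfl⟩

theorem card_edgeClass_eq_tgt (a : E) :
    Nat.card {b // r (G.src a) (G.src b) ∧ G.lab a = G.lab b} =
      Nat.card {y // r (G.tgt a) y} := by
  refine Nat.card_congr (Equiv.ofBijective
    (fun b => ⟨G.tgt b.1, hr.rel_tgt b.2.1 b.2.2.symm⟩) ⟨?_, ?_⟩)
  · rintro ⟨b, hb⟩ ⟨c, hc⟩ h
    exact Subtype.ext (G.eq_of_tgt (congrArg Subtype.val h) (hb.2.symm.trans hc.2))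
  · rintro ⟨y, hy⟩
    obtain ⟨b, rfl, h₂, h₃⟩ := hr.lift_tgt a y hy
    exact ⟨⟨b, h₃, h₂.symm⟩, rfl⟩

/-- On a graph of Euler characteristic one a bisimulation is trivial: all its classes of vertices
and of edges have the same size, which therefore divides the Euler characteristic. -/
theorem eq_of_rel [Finite V] [Finite E] (hcard : Nat.card V = Nat.card E + 1) {x y : V}
    (hxy : r x y) : x = y := by
  have hV : ∀ z, Nat.card {y // r z y} = Nat.card {y // r x y} := fun z =>
    G.eq_of_forall_edge (fun z => Nat.card {y // r z y})
      (fun a => (hr.card_edgeClass_eq_src a).symm.trans (hr.card_edgeClass_eq_tgt a)) z x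
  let rE : Setoid E :=
    { r := fun a b => r (G.src a) (G.src b) ∧ G.lab a = G.lab b
      iseqv := ⟨fun a => ⟨r.refl _, rfl⟩, fun h => ⟨r.symm h.1, h.2.symm⟩,
        fun h h' => ⟨r.trans h.1 h'.1, h.2.trans h'.2⟩⟩ }
  have h₁ := dvd_natCard_of_classes r _ hV
  have h₂ := dvd_natCard_of_classes rE _ fun a => (hr.card_edgeClass_eq_src a).trans (hV _)
  rw [hcard, Nat.dvd_add_right h₂, Nat.dvd_one] at h₁
  have := (Nat.card_eq_one_iff_unique.1 h₁).1
  exact congrArg Subtype.val (Subsingleton.elim (⟨x, r.refl x⟩ : {y // r x y}) ⟨y, hxy⟩)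

end IsBisimulation

/-! ### The simulation order -/

/-- A relation `S` such that, for `S n m`, edges out of `m` lift to edges out of `n` and edges
into `n` lift to edges into `m`. -/
structure IsSimulation (S : V → V → Prop) : Prop where
  lift_src : ∀ n b, S n (G.src b) → ∃ a, G.src a = n ∧ G.lab a = G.lab b ∧ S (G.tgt a) (G.tgt b)
  lift_tgt : ∀ a m, S (G.tgt a) m → ∃ b, G.tgt b = m ∧ G.lab b = G.lab a ∧ S (G.src a) (G.src b)

/-- The union of all simulations. -/
def Simulates (n m : V) : Prop := ∃ S, G.IsSimulation S ∧ S n m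

theorem Simulates.refl (n : V) : G.Simulates n n :=
  ⟨Eq, ⟨fun _ b h => ⟨b, h.symm, rfl, rfl⟩, fun a _ h => ⟨a, h, rfl, rfl⟩⟩, rfl⟩

variable {G}

theorem Simulates.trans {l m n : V} (h : G.Simulates l m) (h' : G.Simulates m n) :
    G.Simulates l n := by
  obtain ⟨S, hS, h⟩ := h
  obtain ⟨S', hS', h'⟩ := h'
  refine ⟨Relation.Comp S S', ⟨?_, ?_⟩, m, h, h'⟩
  · rintro l c ⟨m, h, h'⟩
    obtain ⟨b, rfl, hb, hb'⟩ := hS'.lift_src _ _ h'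
    obtain ⟨a, rfl, ha, ha'⟩ := hS.lift_src _ _ h
    exact ⟨a, rfl, ha.trans hb, _, ha', hb'⟩
  · rintro a n ⟨m, h, h'⟩
    obtain ⟨b, rfl, hb, hb'⟩ := hS.lift_tgt _ _ h
    obtain ⟨c, rfl, hc, hc'⟩ := hS'.lift_tgt _ _ h'
    exact ⟨c, rfl, hc.trans hb, _, hb', hc'⟩

variable (G) in
theorem isSimulation_simulates : G.IsSimulation G.Simulates where
  lift_src n b := by
    rintro ⟨S, hS, h⟩
    obtain ⟨a, h₁, h₂, h₃⟩ := hS.lift_src _ _ h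
    exact ⟨a, h₁, h₂, S, hS, h₃⟩
  lift_tgt a m := by
    rintro ⟨S, hS, h⟩
    obtain ⟨b, h₁, h₂, h₃⟩ := hS.lift_tgt _ _ h
    exact ⟨b, h₁, h₂, S, hS, h₃⟩

variable (G) in
/-- Mutual simulation. -/
def mutualSimulation : Setoid V where
  r n m := G.Simulates n m ∧ G.Simulates m n
  iseqv := ⟨fun n => ⟨.refl G n, .refl G n⟩, And.symm,
    fun h h' => ⟨h.1.trans h'.1, h'.2.trans h.2⟩⟩

variable (G) in
-- Lift `a` along one simulation to an edge `b` at `y`, then lift `b` back along the other. The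
-- result has the label of `a` and shares an end with it, hence is `a`; so the opposite ends of `a`
-- and `b` simulate each other.
theorem isBisimulation_mutualSimulation : G.IsBisimulation G.mutualSimulation where
  lift_src a y := by
    rintro ⟨h, h'⟩
    obtain ⟨b, rfl, hb, hb'⟩ := G.isSimulation_simulates.lift_src _ _ h'
    obtain ⟨c, hc, hc', hc''⟩ := G.isSimulation_simulates.lift_src _ _ h
    rw [G.eq_of_src hc (hc'.trans hb)] at hc''
    exact ⟨b, rfl, hb, hc'', hb'⟩
  lift_tgt a y := by
    rintro ⟨h, h'⟩
    obtain ⟨b, rfl, hb, hb'⟩ := G.isSimulation_simulates.lift_tgt _ _ h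
    obtain ⟨c, hc, hc', hc''⟩ := G.isSimulation_simulates.lift_tgt _ _ h'
    rw [G.eq_of_tgt hc (hc'.trans hb)] at hc''
    exact ⟨b, rfl, hb, hb', hc''⟩

theorem Simulates.antisymm [Finite V] [Finite E] (hcard : Nat.card V = Nat.card E + 1) {n m : V}
    (h : G.Simulates n m) (h' : G.Simulates m n) : n = m :=
  G.isBisimulation_mutualSimulation.eq_of_rel hcard (show G.mutualSimulation n m from ⟨h, h'⟩)

/-! ### Endomorphisms of the representation given by a labelled graph -/

variable {K : Type*} [Field K]

variable (G) in
/-- The matrices that commute with the partial permutation matrices given by the labels. -/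
structure IsEndomorphism (P : Matrix V V K) : Prop where
  tgt_eq_src : ∀ a b, G.lab a = G.lab b → P (G.tgt b) (G.tgt a) = P (G.src b) (G.src a)
  tgt_eq_zero : ∀ a m, (∀ b, G.tgt b = m → G.lab b ≠ G.lab a) → P m (G.tgt a) = 0
  src_eq_zero : ∀ b n, (∀ a, G.src a = n → G.lab a ≠ G.lab b) → P (G.src b) n = 0

namespace IsEndomorphism

variable {P : Matrix V V K} (hP : G.IsEndomorphism P)
include hP

/-- The support of `P` is itself a simulation: a nonzero entry forces the required edge to exist,
and is carried unchanged along it. -/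
theorem simulates {n m : V} (h : P m n ≠ 0) : G.Simulates n m := by
  refine ⟨fun n m => P m n ≠ 0, ⟨fun n b hb => ?_, fun a m ha => ?_⟩, h⟩
  · by_contra! hc
    refine hb (hP.src_eq_zero b n fun a h₁ h₂ => ?_)
    subst h₁
    exact hb ((hP.tgt_eq_src a b h₂).symm.trans (hc a rfl h₂))
  · by_contra! hc
    refine ha (hP.tgt_eq_zero a m fun b h₁ h₂ => ?_)
    subst h₁
    exact ha ((hP.tgt_eq_src a b h₂.symm).trans (hc b rfl h₂))

theorem diag_eq (n m : V) : P n n = P m m :=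
  G.eq_of_forall_edge (fun n => P n n) (fun a => (hP.tgt_eq_src a a rfl).symm) n m

variable [Fintype V] [Finite E] (hcard : Nat.card V = Nat.card E + 1)
include hcard

theorem isIdempotentElem_diag (hidem : IsIdempotentElem P) (n : V) : IsIdempotentElem (P n n) := by
  have h := congrFun (congrFun hidem n) n
  rw [Matrix.mul_apply, Finset.sum_eq_single n] at h
  · exact h
  · intro m _ hm
    -- A nonzero off-diagonal term `P n m * P m n` would make `n` and `m` simulate each other.
    by_contra! hne
    exact hm ((hP.simulates (left_ne_zero_of_mul hne)).antisymm hcard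
      (hP.simulates (right_ne_zero_of_mul hne)))
  · simp

/-- In `P m n = ∑ l, P m l * P l n` only `l ≤ m` can contribute; `l = m` is killed by the diagonal
and `l < m` by induction on `m`. -/
theorem eq_zero_of_diag (hidem : IsIdempotentElem P) (h₀ : ∀ n, P n n = 0) : P = 0 := by
  let : PartialOrder V :=
    { le := G.Simulates
      le_refl := Simulates.refl G
      le_trans := fun _ _ _ => Simulates.trans
      le_antisymm := fun _ _ => Simulates.antisymm hcard }
  ext m n
  induction m using WellFoundedLT.induction with
  | ind m ih =>
  rw [Matrix.zero_apply, ← congrFun (congrFun hidem m) n, Matrix.mul_apply]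
  refine Finset.sum_eq_zero fun l _ => ?_
  by_contra! hne
  have hle : l ≤ m := hP.simulates (left_ne_zero_of_mul hne)
  obtain rfl | hlt := hle.eq_or_lt
  · exact left_ne_zero_of_mul hne (h₀ _)
  · exact right_ne_zero_of_mul hne (ih l hlt)

omit hcard [Fintype V] [Finite E] in
theorem one_sub [DecidableEq V] : G.IsEndomorphism (1 - P) where
  tgt_eq_src a b h := by
    -- Equally labelled edges that share one end coincide, so the identity matrix takes equal values
    -- at their two ends.
    have : G.tgt b = G.tgt a ↔ G.src b = G.src a :=
      ⟨fun h' => by rw [G.eq_of_tgt h' h.symm], fun h' => by rw [G.eq_of_src h' h.symm]⟩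
    simp only [Matrix.sub_apply, Matrix.one_apply, hP.tgt_eq_src a b h, this]
  tgt_eq_zero a m h := by
    rw [Matrix.sub_apply, hP.tgt_eq_zero a m h, Matrix.one_apply_ne, sub_zero]
    rintro rfl
    exact h a rfl rfl
  src_eq_zero b n h := by
    rw [Matrix.sub_apply, hP.src_eq_zero b n h, Matrix.one_apply_ne, sub_zero]
    rintro rfl
    exact h b rfl rfl

theorem eq_zero_or_eq_one [DecidableEq V] (hidem : IsIdempotentElem P) : P = 0 ∨ P = 1 := by
  obtain h | ⟨⟨n⟩⟩ := isEmpty_or_nonempty V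
  · exact .inl (Subsingleton.elim _ _)
  obtain h | h := IsIdempotentElem.iff_eq_zero_or_one.1 (hP.isIdempotentElem_diag hcard hidem n)
  · exact .inl (hP.eq_zero_of_diag hcard hidem fun m => (hP.diag_eq m n).trans h)
  · refine .inr (sub_eq_zero.1 (hP.one_sub.eq_zero_of_diag hcard hidem.one_sub fun m => ?_)).symm
    rw [Matrix.sub_apply, Matrix.one_apply_eq, hP.diag_eq m n, h, sub_self]

end IsEndomorphism

end LabelledGraph

/-! ### Tree modules in coordinates -/

section Coordinates

variable {K : Type w} [Field K] {Q : Type u} [Quiver.{v} Q] {T : Type u'} [Quiver.{v'} T]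

theorem star_eq_of_total_eq {j k k' : Q} {γ : j ⟶ k} {γ' : j ⟶ k'}
    (h : (⟨j, k, γ⟩ : Quiver.Total Q) = ⟨j, k', γ'⟩) :
    Quiver.Star.mk γ = Quiver.Star.mk γ' := by
  cases h
  rfl

theorem costar_eq_of_total_eq {j j' k : Q} {γ : j ⟶ k} {γ' : j' ⟶ k}
    (h : (⟨j, k, γ⟩ : Quiver.Total Q) = ⟨j', k, γ'⟩) :
    Quiver.Costar.mk γ = Quiver.Costar.mk γ' := by
  cases h
  rfl

theorem total_eq_of_cast_eq {j k j' k' : Q} {γ : j ⟶ k} {γ' : j' ⟶ k'} {hj : j = j'} {hk : k = k'}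
    (h : γ.cast hj hk = γ') : (⟨j, k, γ⟩ : Quiver.Total Q) = ⟨j', k', γ'⟩ := by
  subst hj hk h
  rfl

/-- The image of an arrow under a quiver morphism. -/
def totalMap (F : T ⥤q Q) (a : Quiver.Total T) : Quiver.Total Q :=
  ⟨F.obj a.left, F.obj a.right, F.map a.hom⟩

theorem TreeModuleCondition.eq_of_left {F : T ⥤q Q} (hF : TreeModuleCondition F)
    {a b : Quiver.Total T} (h : a.left = b.left) (hl : totalMap F a = totalMap F b) : a = b := by
  obtain ⟨n, m, a⟩ := a
  obtain ⟨n', m', b⟩ := b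
  obtain rfl : n = n' := h
  cases hF.1 n (show F.star n (Quiver.Star.mk a) = F.star n (Quiver.Star.mk b) from
    star_eq_of_total_eq hl)
  rfl

theorem TreeModuleCondition.eq_of_right {F : T ⥤q Q} (hF : TreeModuleCondition F)
    {a b : Quiver.Total T} (h : a.right = b.right) (hl : totalMap F a = totalMap F b) :
    a = b := by
  obtain ⟨n, m, a⟩ := a
  obtain ⟨n', m', b⟩ := b
  obtain rfl : m = m' := h
  cases hF.2 m (show F.costar m (Quiver.Costar.mk a) = F.costar m (Quiver.Costar.mk b) from
    costar_eq_of_total_eq hl)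
  rfl

/-- A tree whose arrows are labelled by their images under a morphism that satisfies the tree module
condition. -/
def IsTree.labelledGraph (hT : IsTree T) {F : T ⥤q Q} (hF : TreeModuleCondition F) :
    LabelledGraph T (Quiver.Total T) (Quiver.Total Q) where
  src := Quiver.Total.left
  tgt := Quiver.Total.right
  lab := totalMap F
  eq_of_src := hF.eq_of_left
  eq_of_tgt := hF.eq_of_right
  connected x y := by
    obtain ⟨p⟩ := hT.graph_isTree.connected.preconnected x y
    induction p with
    | nil => exact .refl _
    | cons h _ ih =>
      refine .trans _ _ _ ?_ ih
      obtain ⟨-, ⟨⟨a⟩⟩ | ⟨⟨a⟩⟩⟩ := (SimpleGraph.fromRel_adj _ _ _).1 h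
      · exact .rel _ _ ⟨⟨_, _, a⟩, rfl, rfl⟩
      · exact .symm _ _ (.rel _ _ ⟨⟨_, _, a⟩, rfl, rfl⟩)

instance [Finite T] [∀ n m : T, Finite (n ⟶ m)] : Finite (Quiver.Total T) :=
  Finite.of_injective (β := Σ n m : T, n ⟶ m) (fun a => ⟨a.left, a.right, a.hom⟩) (by
    rintro ⟨n, m, a⟩ ⟨n', m', b⟩ h
    cases h
    rfl)

/-- Without loops or multiple arrows, the arrows of `T` correspond to the edges of its underlying
simple graph. -/
theorem IsTree.natCard_eq [Finite T] (hT : IsTree T) :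
    Nat.card T = Nat.card (Quiver.Total T) + 1 := by
  classical
  have := Fintype.ofFinite T
  rw [Nat.card_eq_fintype_card, ← hT.graph_isTree.card_edgeFinset, SimpleGraph.edgeFinset_card,
    ← Nat.card_eq_fintype_card]
  congr 1
  symm
  have hne : ∀ a : Quiver.Total T, a.left ≠ a.right := by
    rintro ⟨n, m, a⟩ (rfl : n = m)
    exact (hT.no_loop n).false a
  have hadj : ∀ a : Quiver.Total T, (underlyingGraph T).Adj a.left a.right := fun a =>
    (SimpleGraph.fromRel_adj (fun n m : T => Nonempty (n ⟶ m)) _ _).2 ⟨hne a, .inl ⟨a.hom⟩⟩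
  refine Nat.card_congr (Equiv.ofBijective
    (fun a : Quiver.Total T => (⟨s(a.left, a.right), hadj a⟩ : (underlyingGraph T).edgeSet))
    ⟨?_, ?_⟩)
  · rintro ⟨n, m, a⟩ ⟨n', m', b⟩ h
    obtain ⟨h₁, h₂⟩ | ⟨h₁, h₂⟩ := Sym2.eq_iff.1 (congrArg Subtype.val h)
    · obtain rfl : n = n' := h₁
      obtain rfl : m = m' := h₂
      cases (hT.no_multiple n m).elim (.inl a) (.inl b)
      rfl
    · obtain rfl : n = m' := h₁
      obtain rfl : m = n' := h₂
      cases (hT.no_multiple n m).elim (.inl a) (.inr b)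
  · rintro ⟨e, he⟩
    induction e with
    | h n m =>
      obtain ⟨-, ⟨⟨a⟩⟩ | ⟨⟨a⟩⟩⟩ :=
        (SimpleGraph.fromRel_adj (fun n m : T => Nonempty (n ⟶ m)) _ _).1 he
      · exact ⟨⟨_, _, a⟩, rfl⟩
      · exact ⟨⟨_, _, a⟩, Subtype.ext Sym2.eq_swap⟩

/-! ### Basis and coordinates of the tree module -/

variable [Finite T] [∀ n m : T, Finite (n ⟶ m)]

/-- The underlying space of `F_λ(V_T)`. -/
abbrev TreeSpace (K : Type w) [Field K] (F : T ⥤q Q) : Type _ := (pushDown F (constRep K T)).Total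

open Classical in
/-- The basis vector of `F_λ(V_T)` at a vertex of `T`. -/
def basisVec (F : T ⥤q Q) (n : T) : TreeSpace K F :=
  DirectSum.lof K Q (pushDown F (constRep K T)).V (F.obj n)
    (DirectSum.lof K (VertexFiber F (F.obj n)) (fun _ => K) ⟨n, rfl⟩ (1 : K))

/-- The coordinate on `F_λ(V_T)` at a vertex of `T`. -/
def coord (F : T ⥤q Q) (m : T) : TreeSpace K F →ₗ[K] K :=
  (DirectSum.component K (VertexFiber F (F.obj m)) (fun _ => K) ⟨m, rfl⟩).comp
    (DirectSum.component K Q (pushDown F (constRep K T)).V (F.obj m))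

theorem coord_ext {F : T ⥤q Q} {x y : TreeSpace K F} (h : ∀ m, coord F m x = coord F m y) :
    x = y := by
  refine DFinsupp.ext fun j => DFinsupp.ext (β := fun _ : VertexFiber F j => K) ?_
  rintro ⟨m, rfl⟩
  exact h m

open Classical in
-- The vertex `k` is kept variable so that it can be substituted by `F.obj n`.
theorem basisVec_apply (F : T ⥤q Q) (n : T) {k : Q} (m : VertexFiber F k) :
    ((show DirectSum (VertexFiber F k) fun _ => K from (basisVec F n : TreeSpace K F) k) m : K) =
      if m.1 = n then 1 else 0 := by
  by_cases h : F.obj n = k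
  · subst h
    have : (basisVec F n : TreeSpace K F) (F.obj n) =
        DirectSum.lof K (VertexFiber F (F.obj n)) (fun _ => K) ⟨n, rfl⟩ (1 : K) :=
      DFinsupp.single_eq_same
    rw [this]
    change DirectSum.of (fun _ : VertexFiber F (F.obj n) => K) ⟨n, rfl⟩ 1 m = _
    simp only [DirectSum.of_apply, Subtype.ext_iff, eq_comm (a := n), eq_rec_constant,
      dite_eq_ite]
  · have : (basisVec F n : TreeSpace K F) k = 0 := DFinsupp.single_eq_of_ne (Ne.symm h)
    rw [this, if_neg]
    · rfl
    · rintro rfl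
      exact h m.2

open Classical in
theorem coord_basisVec (F : T ⥤q Q) (m n : T) :
    coord F m (basisVec F n : TreeSpace K F) = if m = n then 1 else 0 := by
  exact basisVec_apply F n ⟨m, rfl⟩

omit [Finite T] [∀ n m : T, Finite (n ⟶ m)] in
-- By the target half of the tree module condition, each coordinate of the action of `γ` is a sum of
-- at most one term.
theorem subsingleton_arrowFiber {F : T ⥤q Q} (hF : TreeModuleCondition F) {j k : Q} (γ : j ⟶ k)
    (m : VertexFiber F k) : Subsingleton (Σ n : VertexFiber F j, ArrowFiber F γ n m) := by
  refine ⟨?_⟩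
  obtain ⟨m, rfl⟩ := m
  rintro ⟨⟨n, rfl⟩, ⟨a, rfl⟩⟩ ⟨⟨n', h⟩, ⟨b, hb⟩⟩
  have : (⟨n, m, a⟩ : Quiver.Total T) = ⟨n', m, b⟩ := by
    refine hF.eq_of_right rfl ?_
    exact (total_eq_of_cast_eq hb).symm
  cases this
  rfl

theorem pushDownMap_apply (F : T ⥤q Q) (U : Rep.{u', v', w, x} K T) {j k : Q} (γ : j ⟶ k)
    (m : VertexFiber F k) [Fintype (Σ n : VertexFiber F j, ArrowFiber F γ n m)]
    (y : DirectSum (VertexFiber F j) fun n => U.V n.1) :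
    pushDownMap F U γ y m =
      ∑ i : (Σ n : VertexFiber F j, ArrowFiber F γ n m), U.map i.2.1 (y i.1) := by
  classical
  let := fun n => Fintype.ofFinite (ArrowFiber F γ n m)
  let := Fintype.ofFinite (VertexFiber F j)
  let := Fintype.ofFinite (VertexFiber F k)
  have hsum : ∑ i : (Σ n : VertexFiber F j, ArrowFiber F γ n m), U.map i.2.1 (y i.1) =
      ∑ n : VertexFiber F j, ∑ a : ArrowFiber F γ n m, U.map a.1 (y n) := by
    rw [← Fintype.sum_sigma']
    congr!
  rw [hsum]
  change DirectSum.component K (VertexFiber F k) (fun m => U.V m.1) m _ = _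
  simp only [pushDownMap, LinearMap.sum_apply, LinearMap.comp_apply, map_sum]
  refine Finset.sum_congr (by congr!) fun n _ => ?_
  rw [Finset.sum_eq_single m]
  · refine Finset.sum_congr (by congr!) fun a _ => ?_
    exact DirectSum.component.lof_self ..
  · intro m' _ hm
    refine Finset.sum_eq_zero fun a _ => ?_
    rw [DirectSum.component.of, dif_neg hm]
  · exact fun h => absurd (Finset.mem_univ _) h

/-! ### Arrows acting as partial permutations of the basis -/

/-- The action of an arrow of `Q` on `F_λ(V_T)`. -/
def actArrow (F : T ⥤q Q) (γ : Quiver.Total Q) : Module.End K (TreeSpace K F) :=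
  (pushDown F (constRep K T)).actPath ⟨γ.left, γ.right, γ.hom.toPath⟩

theorem actArrow_apply (F : T ⥤q Q) (γ : Quiver.Total Q) (y : TreeSpace K F) :
    actArrow F γ y γ.right = pushDownMap F (constRep K T) γ.hom (y γ.left) :=
  open scoped Classical in DFinsupp.single_eq_same

theorem actArrow_apply_of_ne (F : T ⥤q Q) {γ : Quiver.Total Q} {k : Q} (h : γ.right ≠ k)
    (y : TreeSpace K F) : actArrow F γ y k = 0 :=
  open scoped Classical in DFinsupp.single_eq_of_ne h.symm

theorem coord_actArrow {F : T ⥤q Q} (hF : TreeModuleCondition F) (a : Quiver.Total T)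
    (y : TreeSpace K F) : coord F a.right (actArrow F (totalMap F a) y) = coord F a.left y := by
  have := subsingleton_arrowFiber hF (F.map a.hom) ⟨a.right, rfl⟩
  have := Fintype.ofFinite
    (Σ n : VertexFiber F (F.obj a.left), ArrowFiber F (F.map a.hom) n ⟨a.right, rfl⟩)
  have h := pushDownMap_apply F (constRep K T) (F.map a.hom) ⟨a.right, rfl⟩ (y (F.obj a.left))
  rw [Fintype.sum_subsingleton _ ⟨⟨a.left, rfl⟩, ⟨a.hom, rfl⟩⟩] at h
  exact (congrArg (fun z : DirectSum (VertexFiber F (F.obj a.right)) fun _ => K => z ⟨a.right, rfl⟩)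
    (actArrow_apply F (totalMap F a) y)).trans h

theorem coord_actArrow_of_ne {F : T ⥤q Q} {γ : Quiver.Total Q} {m : T}
    (h : ∀ b : Quiver.Total T, b.right = m → totalMap F b ≠ γ)
    (y : TreeSpace K F) : coord F m (actArrow F γ y) = 0 := by
  classical
  obtain ⟨j, k, γ⟩ := γ
  by_cases hk : k = F.obj m
  · subst hk
    have : IsEmpty (Σ n : VertexFiber F j, ArrowFiber F γ n ⟨m, rfl⟩) :=
      ⟨fun i => h ⟨_, _, i.2.1⟩ rfl (total_eq_of_cast_eq i.2.2)⟩
    have := Fintype.ofIsEmpty (α := Σ n : VertexFiber F j, ArrowFiber F γ n ⟨m, rfl⟩)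
    have h' := pushDownMap_apply F (constRep K T) γ ⟨m, rfl⟩ (y j)
    rw [Fintype.sum_empty] at h'
    exact (congrArg (fun z : DirectSum (VertexFiber F (F.obj m)) fun _ => K => z ⟨m, rfl⟩)
      (actArrow_apply F ⟨j, _, γ⟩ y)).trans h'
  · exact congrArg (fun z : DirectSum (VertexFiber F (F.obj m)) fun _ => K => z ⟨m, rfl⟩)
      (actArrow_apply_of_ne F (γ := ⟨j, k, γ⟩) hk y)

theorem actArrow_basisVec {F : T ⥤q Q} (hF : TreeModuleCondition F) (a : Quiver.Total T) :
    actArrow F (totalMap F a) (basisVec F a.left : TreeSpace K F) = basisVec F a.right := by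
  classical
  refine coord_ext fun m => ?_
  by_cases h : ∃ b : Quiver.Total T, b.right = m ∧ totalMap F b = totalMap F a
  · obtain ⟨b, rfl, hb⟩ := h
    rw [← hb, coord_actArrow hF, coord_basisVec, coord_basisVec]
    have : b.left = a.left ↔ b.right = a.right :=
      ⟨fun h => by rw [hF.eq_of_left h hb], fun h => by rw [hF.eq_of_right h hb]⟩
    simp only [this]
  · push Not at h
    rw [coord_actArrow_of_ne h, coord_basisVec, if_neg]
    rintro rfl
    exact h a rfl rfl

theorem actArrow_basisVec_of_ne {F : T ⥤q Q} (hF : TreeModuleCondition F) {γ : Quiver.Total Q}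
    {n : T} (h : ∀ a : Quiver.Total T, a.left = n → totalMap F a ≠ γ) :
    actArrow F γ (basisVec F n : TreeSpace K F) = 0 := by
  classical
  refine coord_ext fun m => ?_
  rw [map_zero]
  by_cases h' : ∃ b : Quiver.Total T, b.right = m ∧ totalMap F b = γ
  · obtain ⟨b, rfl, rfl⟩ := h'
    rw [coord_actArrow hF, coord_basisVec, if_neg]
    exact fun hb => h b hb rfl
  · push Not at h'
    rw [coord_actArrow_of_ne h']

theorem sum_coord_smul_basisVec [Fintype T] (F : T ⥤q Q) (y : TreeSpace K F) :
    ∑ n, coord F n y • basisVec F n = y := by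
  classical
  refine coord_ext fun m => ?_
  simp [coord_basisVec]

/-! ### Matrices of endomorphisms -/

/-- The matrix of an endomorphism of the space `F_λ(V_T)`. -/
def coordMatrix (F : T ⥤q Q) (p : Module.End K (TreeSpace K F)) : Matrix T T K :=
  fun m n => coord F m (p (basisVec F n))

theorem coordMatrix_injective (F : T ⥤q Q) :
    Function.Injective (coordMatrix F : Module.End K (TreeSpace K F) → Matrix T T K) := by
  have := Fintype.ofFinite T
  intro p q h
  refine LinearMap.ext fun y => ?_
  rw [← sum_coord_smul_basisVec F y, map_sum, map_sum]
  refine Finset.sum_congr rfl fun n _ => ?_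
  rw [map_smul, map_smul]
  congr 1
  exact coord_ext fun m => congrFun (congrFun h m) n

theorem coordMatrix_mul [Fintype T] (F : T ⥤q Q) (p q : Module.End K (TreeSpace K F)) :
    coordMatrix F (p * q) = coordMatrix F p * coordMatrix F q := by
  ext m n
  rw [Matrix.mul_apply, coordMatrix, Module.End.mul_apply,
    ← sum_coord_smul_basisVec F (q (basisVec F n)), map_sum, map_sum]
  refine Finset.sum_congr rfl fun l _ => ?_
  rw [map_smul, map_smul, smul_eq_mul, mul_comm]
  rfl

theorem coordMatrix_one [DecidableEq T] (F : T ⥤q Q) :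
    coordMatrix F (1 : Module.End K (TreeSpace K F)) = 1 := by
  ext m n
  rw [coordMatrix, Module.End.one_apply, coord_basisVec, Matrix.one_apply]
  congr

/-- Each condition comes from writing a basis vector at a target, or a coordinate at a source,
through the action of an arrow, and moving that action past `p`. -/
theorem isEndomorphism_coordMatrix (hT : IsTree T) {F : T ⥤q Q} (hF : TreeModuleCondition F)
    {p : Module.End K (TreeSpace K F)} (hp : ∀ γ, Commute p (actArrow F γ)) :
    (hT.labelledGraph hF).IsEndomorphism (coordMatrix F p) := by
  have hp' : ∀ γ y, p (actArrow F γ y) = actArrow F γ (p y) := fun γ y =>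
    LinearMap.congr_fun (hp γ).eq y
  refine ⟨fun a b hab => ?_, fun a m h => ?_, fun b n h => ?_⟩
  · change totalMap F a = totalMap F b at hab
    change coord F b.right (p (basisVec F a.right)) = coord F b.left (p (basisVec F a.left))
    rw [← actArrow_basisVec hF, hp', hab, coord_actArrow hF]
  · change coord F m (p (basisVec F a.right)) = 0
    rw [← actArrow_basisVec hF, hp']
    exact coord_actArrow_of_ne h _
  · change coord F b.left (p (basisVec F n)) = 0
    rw [← coord_actArrow hF, ← hp',
      show actArrow F (totalMap F b) (basisVec F n) = 0 from actArrow_basisVec_of_ne hF h,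
      map_zero, map_zero]

/-- An idempotent endomorphism of a tree module is trivial. -/
theorem eq_zero_or_eq_one_of_commute (hT : IsTree T) {F : T ⥤q Q} (hF : TreeModuleCondition F)
    {p : Module.End K (TreeSpace K F)} (hidem : IsIdempotentElem p)
    (hp : ∀ γ, Commute p (actArrow F γ)) : p = 0 ∨ p = 1 := by
  classical
  have := Fintype.ofFinite T
  have hidem' : IsIdempotentElem (coordMatrix F p) := by
    rw [IsIdempotentElem, ← coordMatrix_mul, hidem.eq]
  refine ((isEndomorphism_coordMatrix hT hF hp).eq_zero_or_eq_one hT.natCard_eq hidem').imp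
    (fun h => coordMatrix_injective F (h.trans ?_))
    (fun h => coordMatrix_injective F (h.trans (coordMatrix_one F).symm))
  ext m n
  exact (map_zero (coord F m)).symm

end Coordinates

/-- An operator commutes with an idempotent exactly when it preserves its range and kernel, here
`N₁` and `N₂`. -/
theorem LeftModule.IsSubmodule.commute_projection {K : Type w} [Field K] {A : Type u}
    [NonUnitalRing A] [Module K A] {M : LeftModule.{u, w, x} K A} {N₁ N₂ : Submodule K M.carrier}
    (h₁ : M.IsSubmodule N₁) (h₂ : M.IsSubmodule N₂) (h : IsCompl N₁ N₂) (a : A) :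
    Commute (N₁.projection N₂ h) (M.act a) := by
  rw [LinearMap.IsIdempotentElem.commute_iff (Submodule.isIdempotentElem_projection h),
    Submodule.range_projection, Submodule.ker_projection]
  exact ⟨h₁ a, h₂ a⟩

end ZeroRelation

end

theorem mainTheorem4 {K : Type*} [Field K] {Q : Type*} [Quiver Q]
    (ρ : Set (ZeroRelation.BasisPath Q)) (hρ : ZeroRelation.IsLocallyBound K ρ)
    {T : Type*} [Quiver T] [Finite T] [∀ n m : T, Finite (n ⟶ m)] (hT : ZeroRelation.IsTree T)
    (F : T ⥤q Q) (hF : ZeroRelation.IsBoundMorphism K ρ F)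
    (hF' : ZeroRelation.TreeModuleCondition F) :
    (ZeroRelation.pushDownModule hF).Indecomposable := by
  classical
  refine ⟨?_, fun N₁ N₂ h₁ h₂ h => ?_⟩
  · obtain ⟨n⟩ := hT.graph_isTree.connected.nonempty
    refine ⟨ZeroRelation.basisVec F n, 0, fun h => one_ne_zero (α := K) ?_⟩
    have := (congrArg (ZeroRelation.coord F n) h).trans (map_zero (ZeroRelation.coord F n))
    rwa [ZeroRelation.coord_basisVec, if_pos rfl] at this
  -- Each arrow acts as the class in `Λ` of a path of length one, so the projection commutes with
  -- it.
  · have hact : ∀ γ, ZeroRelation.actArrow F γ = (ZeroRelation.pushDownModule hF).act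
        (.mk K ρ (.ofPath K ⟨γ.left, γ.right, γ.hom.toPath⟩)) := fun γ =>
      (ZeroRelation.Rep.actPathAlgebra_ofPath _ _).symm
    have hidem := Submodule.isIdempotentElem_projection h
    obtain h' | h' := ZeroRelation.eq_zero_or_eq_one_of_commute hT hF' hidem
      fun γ => hact γ ▸ h₁.commute_projection h₂ h _
    · left
      rw [← Submodule.range_projection h]
      exact LinearMap.range_eq_bot.2 h'
    · right
      rw [← Submodule.ker_projection h]
      exact LinearMap.ker_eq_bot.2 (h' ▸ Function.injective_id)
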